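/- **Setting.** All sequences are infinite binary sequences $\mathbf u=(u_0,u_1,u_2,\dots)$ over $\mathbb F_2$; $L$ is the left shift, $[\mathbf u]=\{L^k\mathbf u: k\ge 0\}$ is the cycle of $\mathbf u$, and $\mathbf u^{(d)}=(u_0,u_d,u_{2d},\dots)$ is the $d$-decimation. For $g=x^n+\sum_{i<n}c_ix^i\in\mathbb F_2[x]$ let $\Omega(g)$ be the set of all $\mathbf u$ with $u_{k+n}=\sum_{i<n}c_iu_{k+i}$ for all $k\ge 0$. The $n$-stage states of a cycle $[\mathbf u]$ are the vectors $(u_k,\dots,u_{k+n-1})$, $k\ge0$. The conjugate of $\mathbf v=(v_0,v_1,\dots,v_{n-1})\in\mathbb F_2^n$ is $\widehat{\mathbf v}=(v_0+1,v_1,\dots,v_{n-1})$. The number of conjugate pairs shared by two cycles $C_1,C_2$ is the number of pairs $(\mathbf v,\widehat{\mathbf v})$ with $\mathbf v$ a state of $C_1$ and $\widehat{\mathbf v}$ a state of $C_2$ (so if $C_1=C_2$, then $(\mathbf v,\widehat{\mathbf v})$ and $(\widehat{\mathbf v},\mathbf v)$ are counted separately). Let $s\ge1$, let $p_1,\dots,p_s\in\mathbb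 F_2[x]$ be pairwise distinct irreducible polynomials, all different from $x$, and let $f=\prod_{i=1}^s p_i$, $n=\deg f$, $n_i=\deg p_i$. Let $e_i$ be the order of $p_i$ (the multiplicative order of its roots) and $t_i=(2^{n_i}-1)/e_i$. For each $i$ let $\alpha_i$ be a primitive element of $\mathbb F_{2^{n_i}}$ such that $\alpha_i^{t_i}$ is a root of $p_i$. For $k\in\mathbb Z$ put $\mathcal C^i_k=\{\alpha_i^{k+rt_i}: 0\le r<e_i\}$, and for $k,l\in\mathbb Z$ let $(k,l)_{t_i}=|\{\xi\in\mathcal C^i_k:\xi+1\in\mathcal C^i_l\}|$ be the cyclotomic numbers. Let $\mathbf s^i_0,\dots,\mathbf s^i_{t_i-1}$ be representatives of the nonzero cycles of $\Omega(p_i)$, numbered according to the cyclotomic classes: for some nonzero $\mathbf m_i\in\Omega(q_i)$, where $q_i$ is the minimal polynomial of $\alpha_i$ over $\mathbb F_2$, one has $[\mathbf s^i_j]=[(L^j\mathbf m_i)^{(t_i)}]$ for $0\le j<t_i$. Let $[\mathbf s_0]$ be the cycle of $\Omega(f)$ that contains the state $(1,0,\dots,0)\in\mathbb F_2^n$, and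 let the nonnegative integers $c_1,\dots,c_s$ and the indices $0\le d_i<t_i$ be such that $[\mathbf s_0]=[L^{c_1}\mathbf s^1_{d_1}+\dots+L^{c_s}\mathbf s^s_{d_s}]$. For $a_i,a_i'\in\mathbb F_2$, indices $0\le j_i,j_i'<t_i$ and nonnegative integers $\ell_i,\ell_i'$ let $$C_1=\Big[\sum_{i=1}^s a_iL^{\ell_i}\mathbf s^i_{j_i}\Big],\qquad C_2=\Big[\sum_{i=1}^s a_i'L^{\ell_i'}\mathbf s^i_{j_i'}\Big],$$ $E_1=\{i:a_i=1\}$, $E_2=\{i:a_i'=1\}$, and let $\Gamma_i$ be the set of pairs $(u,v)$ with $0\le u,v<e_i$ and $L^u(a_i\mathbf s^i_{j_i})+L^v(a_i'\mathbf s^i_{j_i'})=\mathbf s^i_{d_i}$, where $u=0$ is required if $a_i=0$ and $v=0$ is required if $a_i'=0$. **Theorem.** 1. The following conditions are necessary for $C_1$ and $C_2$ to share at least one conjugate pair: (a) $E_1\cup E_2=\{1,\dots,s\}$; (b) $\mathbf s^i_{j_i}=\mathbf s^i_{d_i}$ for every $i\in E_1\setminus E_2$, and $\mathbf s^i_{j_i'}=\mathbf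 s^i_{d_i}$ for every $i\in E_2\setminus E_1$; (c) $(j_i-d_i,\,j_i'-d_i)_{t_i}>0$ for every $i\in E_1\cap E_2$. 2. The number of conjugate pairs shared by $C_1$ and $C_2$ equals the number of tuples $((u_1,v_1),\dots,(u_s,v_s))$ with $(u_i,v_i)\in\Gamma_i$ for all $i$ such that $$c_i+u_i-\ell_i\equiv c_k+u_k-\ell_k \pmod{\gcd(e_i,e_k)}\quad\text{for all } i\ne k\in E_1,$$ $$c_i+v_i-\ell_i'\equiv c_k+v_k-\ell_k' \pmod{\gcd(e_i,e_k)}\quad\text{for all } i\ne k\in E_2.$$ 3. Fix $a_i,a_i',j_i,j_i'$ such that (a) and (b) hold. Let $f_i=e_i$ if $a_i=1$ and $f_i=1$ if $a_i=0$, define $f_i'$ likewise from $a_i'$, and let $\ell_i$ and $\ell_i'$ range over $0\le\ell_i<\gcd(f_i,\operatorname{lcm}(f_1,\dots,f_{i-1}))$ and $0\le\ell_i'<\gcd(f_i',\operatorname{lcm}(f_1',\dots,f_{i-1}'))$ (the empty $\operatorname{lcm}$ being $1$, so that $\ell_1=\ell_1'=0$). Then the sum, over all these values, of the numbers of conjugate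 pairs shared by $C_1$ and $C_2$ equals $$\prod_{i\in E_1\cap E_2}(j_i-d_i,\,j_i'-d_i)_{t_i}.$$ -/

import Mathlib

open Polynomial

namespace FSR

/-- Infinite binary sequences `s_0, s_1, s_2, …`. -/
abbrev BinSeq : Type := ℕ → ZMod 2

/-- The LFSR with characteristic polynomial `f = x^n + ∑_{i<n} c_i x^i` over `𝔽₂`, whose feedback
function is `h(x_0, …, x_{n-1}) = ∑_{i<n} c_i x_i`. -/
def lfsr (f : (ZMod 2)[X]) : LinearRecurrence (ZMod 2) where
  order := f.natDegree
  coeffs := fun i => f.coeff i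

/-- `Ω(f)`: the set of all sequences generated by the LFSR with characteristic polynomial `f`. -/
def Omega (f : (ZMod 2)[X]) : Set BinSeq := {u | (lfsr f).IsSolution u}

/-- The `k`-th power `L^k` of the left shift operator. -/
def shift (k : ℕ) (u : BinSeq) : BinSeq := fun m => u (m + k)

/-- The cycle (shift equivalence class) `[u]`. -/
def cycle (u : BinSeq) : Set BinSeq := Set.range fun k => shift k u

/-- The `d`-decimation `u^{(d)}`. -/
def decimate (d : ℕ) (u : BinSeq) : BinSeq := fun m => u (d * m)

/-- `n`-stage states. -/
abbrev State (n : ℕ) : Type := Fin n → ZMod 2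

/-- The `0`-th `n`-stage state of a sequence. -/
def initialState (n : ℕ) (u : BinSeq) : State n := fun k => u k

/-- The `n`-stage states belonging to a cycle `C`; as `C` is closed under shifts, they are the
`0`-th states of the members of `C`. -/
def states (n : ℕ) (C : Set BinSeq) : Set (State n) := initialState n '' C

/-- The special state `S = (1, 0, …, 0)`. -/
def specialState (n : ℕ) : State n := fun k => if (k : ℕ) = 0 then 1 else 0

/-- The conjugate `(v_0 + 1, v_1, …, v_{n-1})` of the state `v`. -/
def conjugate {n : ℕ} (v : State n) : State n := fun k => if (k : ℕ) = 0 then v k + 1 else v k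

/-- The conjugate pairs `(v, v̂)` with `v` in `C₁` and `v̂` in `C₂`. For distinct (hence disjoint)
cycles every conjugate pair shared by `C₁` and `C₂` occurs exactly once; for `C₁ = C₂` the pairs
`(v, v̂)` and `(v̂, v)` are counted separately. -/
def sharedConjugatePairs (n : ℕ) (C₁ C₂ : Set BinSeq) : Set (State n × State n) :=
  {w | w.1 ∈ states n C₁ ∧ w.2 ∈ states n C₂ ∧ w.2 = conjugate w.1}

/-- The order of the polynomial `p`, i.e. the multiplicative order of a root of `p`: the least
`e > 0` with `p ∣ x^e - 1`. -/
noncomputable def polyOrder (p : (ZMod 2)[X]) : ℕ := orderOf (AdjoinRoot.root p)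

/-- `t = (2^n - 1) / e` for `p` of degree `n` and order `e`. -/
noncomputable def polyIndex (p : (ZMod 2)[X]) : ℕ := (2 ^ p.natDegree - 1) / polyOrder p

/-- The cyclotomic class `𝒞_i = {α^{i + k t} | 0 ≤ k < e}`; for `α` of order `e t`, it depends
only on `i` modulo `t`. -/
def cyclotomicClass {K : Type*} [Field K] (α : K) (t e : ℕ) (i : ℤ) : Set K :=
  {ξ | ∃ k : ℕ, k < e ∧ ξ = α ^ (i + (k : ℤ) * (t : ℤ))}

/-- The cyclotomic number `(i, j)_t = |{ξ | ξ ∈ 𝒞_i, ξ + 1 ∈ 𝒞_j}|`. -/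
noncomputable def cyclotomicNumber {K : Type*} [Field K] (α : K) (t e : ℕ) (i j : ℤ) : ℕ :=
  Set.ncard {ξ : K | ξ ∈ cyclotomicClass α t e i ∧ ξ + 1 ∈ cyclotomicClass α t e j}

/-- The nonzero cycles `[σ 0], …, [σ (t-1)]` of `Ω(p)` are numbered according to the cyclotomic
classes relative to `α`: `α` is a primitive element of `K = 𝔽_{2^n}` such that `α^t` is a root of
`p`, and, for some `m`-sequence `m` generated by the minimal polynomial of `α` (an associated
primitive polynomial of `p`), `[σ j]` is the cycle of `(L^j m)^{(t)}` for all `j < t`. -/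
def CyclotomicLabelling (p : (ZMod 2)[X]) {K : Type*} [Field K] [Algebra (ZMod 2) K] (α : K)
    (σ : Fin (polyIndex p) → BinSeq) : Prop :=
  Nat.card K = 2 ^ p.natDegree ∧
  orderOf α = 2 ^ p.natDegree - 1 ∧
  aeval (α ^ polyIndex p) p = 0 ∧
  ∃ m : BinSeq, m ∈ Omega (minpoly (ZMod 2) α) ∧ m ≠ 0 ∧
    ∀ j : Fin (polyIndex p), cycle (σ j) = cycle (decimate (polyIndex p) (shift j m))

/-- `a_1 L^{ℓ_1} x_1 + ⋯ + a_s L^{ℓ_s} x_s`. -/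
def combination {s : ℕ} (a : Fin s → ZMod 2) (ℓ : Fin s → ℕ) (x : Fin s → BinSeq) : BinSeq :=
  ∑ i, a i • shift (ℓ i) (x i)

/-- The pairs `(u, v)`, `0 ≤ u, v < e`, with `L^u x + L^v y = z`, where `u = 0` is required if
`x` is the zero sequence and `v = 0` is required if `y` is the zero sequence. -/
def Gamma (e : ℕ) (x y z : BinSeq) : Set (ℕ × ℕ) :=
  {w | w.1 < e ∧ w.2 < e ∧ (x = 0 → w.1 = 0) ∧ (y = 0 → w.2 = 0) ∧
    shift w.1 x + shift w.2 y = z}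

/-- The period `f_i` of the component `a_i s^i_j`: it is `e_i` if `a_i = 1` and `1` if
`a_i = 0`. -/
def compPeriod {s : ℕ} (e : Fin s → ℕ) (a : Fin s → ZMod 2) (i : Fin s) : ℕ :=
  if a i = 1 then e i else 1

/-- All values of the shift parameters `(ℓ_1, …, ℓ_s)` in the cycle structure of `Ω(f)`:
`0 ≤ ℓ_i < gcd(f_i, lcm(f_1, …, f_{i-1}))`; in particular `ℓ_1 = 0`. -/
def shiftParameters {s : ℕ} (e : Fin s → ℕ) (a : Fin s → ZMod 2) : Finset (Fin s → ℕ) :=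
  Fintype.piFinset fun i =>
    Finset.range (Nat.gcd (compPeriod e a i) ((Finset.Iio i).lcm (compPeriod e a)))

end FSR

/-!
The sequences of `Ω(f)` are those annihilated by `f(L)`, where `L` is the shift, and they are
determined by their first `n` terms. Hence a conjugate pair shared by `C₁` and `C₂` is a pair
`(w₁, w₂)` of sequences in `C₁ × C₂` with `w₁ + w₂ = z`, where `z` is the sequence whose initial
state is `(1, 0, …, 0)` (`FSR.ncard_sharedConjugatePairs`).

The `p_i` are pairwise coprime, so the equation `w₁ + w₂ = z` may be read off in each `Ω(p_i)`
separately (`FSR.eq_of_sum_eq_sum`). The `i`-th component of a member of `C₁` is a shift of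
`a_i s^i_{j_i}`, so, after a shift, the component equations say that a pair of shift exponents lies
in `Γ_i`. Conversely, given elements of all the `Γ_i`, the summands so obtained lie in `C₁` and
`C₂` if and only if the shift exponents are realized by one common shift, which the Chinese
remainder theorem for non-coprime moduli turns into the congruences modulo `gcd(e_i, e_k)`
(`FSR.combination_mem_cycle_iff`, `FSR.ncard_pairs_with_sum`).

To count `Γ_i`, let `K = 𝔽_{2^{n_i}}` and `γ = α ^ t`. The `m`-sequence has the form
`k ↦ λ (α ^ k)` for a linear functional `λ`, and `ξ ↦ (k ↦ λ (ξ γ ^ k))` embeds `K` into `Ω(p_i)`,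
turning the shift into multiplication by `γ` and the cycle `[σ j]` into the `j`-th cyclotomic class
(`FSR.CyclotomicLabelling.exists_embedding`). Dividing the equation defining `Γ_i` by the element
of `σ d` gives the cyclotomic number (`FSR.CyclotomicLabelling.ncard_Gamma`).

For the sum over all shift parameters, each tuple of elements of the `Γ_i` satisfies the congruences
for exactly one choice of the parameters (`FSR.card_filter_shiftParameters`), so the sum is the
product of the cardinalities of the `Γ_i`.
-/

/-! ### Simultaneous congruences to moduli that need not be coprime -/

lemma Nat.gcd_lcm_distrib {a m n : ℕ} (ha : a ≠ 0) (hm : m ≠ 0) (hn : n ≠ 0) :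
    Nat.gcd a (Nat.lcm m n) = Nat.lcm (Nat.gcd a m) (Nat.gcd a n) := by
  have h₁ : Nat.gcd a m ≠ 0 := Nat.gcd_ne_zero_left ha
  have h₂ : Nat.gcd a n ≠ 0 := Nat.gcd_ne_zero_left ha
  have h₃ : Nat.lcm m n ≠ 0 := Nat.lcm_ne_zero hm hn
  refine Nat.eq_of_factorization_eq (Nat.gcd_ne_zero_left ha) (Nat.lcm_ne_zero h₁ h₂) fun q => ?_
  rw [Nat.factorization_gcd ha h₃, Nat.factorization_lcm hm hn, Nat.factorization_lcm h₁ h₂,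
    Nat.factorization_gcd ha hm, Nat.factorization_gcd ha hn]
  exact inf_sup_left _ _ _

lemma Finset.lcm_nat_ne_zero {ι : Type*} {f : ι → ℕ} (hf : ∀ i, f i ≠ 0) (S : Finset ι) :
    S.lcm f ≠ 0 := by
  rw [Ne, Finset.lcm_eq_zero_iff]
  rintro ⟨i, -, hi⟩
  exact hf i hi

lemma Finset.gcd_lcm_dvd {ι : Type*} {f : ι → ℕ} (hf : ∀ i, f i ≠ 0) {a : ℕ} (ha : a ≠ 0)
    {x : ℤ} (S : Finset ι) (h : ∀ k ∈ S, (Nat.gcd a (f k) : ℤ) ∣ x) :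
    (Nat.gcd a (S.lcm f) : ℤ) ∣ x := by
  classical
  induction S using Finset.induction_on with
  | empty => simp
  | insert k S hk ih =>
    have h₁ := h k (Finset.mem_insert_self _ _)
    have h₂ := ih fun i hi => h i (Finset.mem_insert_of_mem hi)
    rw [Finset.lcm_insert]
    change ((Nat.gcd a (Nat.lcm (f k) (S.lcm f)) : ℕ) : ℤ) ∣ x
    rw [Nat.gcd_lcm_distrib ha (hf k) (Finset.lcm_nat_ne_zero hf S), Int.natCast_dvd]
    exact Nat.lcm_dvd (Int.natCast_dvd.1 h₁) (Int.natCast_dvd.1 h₂)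

lemma Int.exists_modEq_modEq {m n : ℕ} {a b : ℤ} (h : a ≡ b [ZMOD (Nat.gcd m n : ℕ)]) :
    ∃ x : ℤ, x ≡ a [ZMOD m] ∧ x ≡ b [ZMOD n] := by
  obtain ⟨q, hq⟩ := h.dvd
  have hb := Nat.gcd_eq_gcd_ab m n
  refine ⟨a + m * (Nat.gcdA m n * q), ?_, ?_⟩
  · exact (Int.modEq_iff_dvd.2 ⟨-(Nat.gcdA m n * q), by ring⟩)
  · refine Int.modEq_iff_dvd.2 ⟨Nat.gcdB m n * q, ?_⟩
    rw [hb] at hq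
    linear_combination hq

/-- The Chinese remainder theorem for moduli that need not be coprime: pairwise compatible
congruences have a common solution. -/
lemma Int.exists_forall_modEq {ι : Type*} {f : ι → ℕ} (hf : ∀ i, f i ≠ 0) (y : ι → ℤ)
    (S : Finset ι) (h : ∀ i ∈ S, ∀ k ∈ S, i ≠ k → y i ≡ y k [ZMOD (Nat.gcd (f i) (f k) : ℕ)]) :
    ∃ x : ℤ, ∀ i ∈ S, x ≡ y i [ZMOD f i] := by
  classical
  induction S using Finset.induction_on with
  | empty => exact ⟨0, by simp⟩
  | insert i S hi ih =>
    obtain ⟨z, hz⟩ := ih fun k hk l hl =>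
      h k (Finset.mem_insert_of_mem hk) l (Finset.mem_insert_of_mem hl)
    have hc : y i ≡ z [ZMOD (Nat.gcd (f i) (S.lcm f) : ℕ)] := by
      refine Int.modEq_iff_dvd.2 (Finset.gcd_lcm_dvd hf (hf i) S fun k hk => ?_)
      have h₁ := h i (Finset.mem_insert_self _ _) k (Finset.mem_insert_of_mem hk)
        (fun e => hi (e ▸ hk))
      have h₂ := (hz k hk).of_dvd (Int.natCast_dvd_natCast.2 (Nat.gcd_dvd_right (f i) (f k)))
      exact (h₁.trans h₂.symm).dvd
    obtain ⟨x, hx₁, hx₂⟩ := Int.exists_modEq_modEq hc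
    refine ⟨x, fun k hk => ?_⟩
    rcases Finset.mem_insert.1 hk with rfl | hk
    · exact hx₁
    · exact (hx₂.of_dvd (Int.natCast_dvd_natCast.2 (Finset.dvd_lcm hk))).trans (hz k hk)

/-- The shift parameters form a transversal: exactly one of them makes a given family of residues
pairwise compatible. The component `ℓ i` is forced modulo `gcd (f i) (lcm_{k<i} f k)` by the
components before it, and any value in that residue class is allowed. -/
lemma existsUnique_shift_compatible {s : ℕ} {f : Fin s → ℕ} (hf : ∀ i, f i ≠ 0) (x : Fin s → ℤ) :
    ∃! ℓ : Fin s → ℕ, (∀ i, ℓ i < Nat.gcd (f i) ((Finset.Iio i).lcm f)) ∧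
      ∀ i k, x i - ℓ i ≡ x k - ℓ k [ZMOD (Nat.gcd (f i) (f k) : ℕ)] := by
  have hg : ∀ i, 0 < Nat.gcd (f i) ((Finset.Iio i).lcm f) := fun i =>
    Nat.pos_of_ne_zero (Nat.gcd_ne_zero_left (hf i))
  have hex : ∀ n, n ≤ s → ∃ ℓ : Fin s → ℕ,
      (∀ i, ℓ i < Nat.gcd (f i) ((Finset.Iio i).lcm f)) ∧
      ∀ i k : Fin s, i.val < n → k.val < n →
        x i - ℓ i ≡ x k - ℓ k [ZMOD (Nat.gcd (f i) (f k) : ℕ)] := by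
    intro n
    induction n with
    | zero => exact fun _ => ⟨0, hg, by simp⟩
    | succ n ih =>
      intro hn
      obtain ⟨ℓ, hℓ, hc⟩ := ih (by omega)
      let i₀ : Fin s := ⟨n, hn⟩
      have hlt : ∀ i ∈ Finset.Iio i₀, i.val < n := fun i hi =>
        Fin.lt_def.1 (Finset.mem_Iio.1 hi)
      obtain ⟨z, hz⟩ := Int.exists_forall_modEq hf (fun i => x i - ℓ i) (Finset.Iio i₀)
        fun i hi k hk _ => hc i k (hlt i hi) (hlt k hk)
      -- `r` is chosen so that `x i₀ - r` is congruent to the common value `z` found so far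
      obtain ⟨r, hr₀, hr₁, hr⟩ := Int.existsUnique_equiv (x i₀ - z)
        (b := (Nat.gcd (f i₀) ((Finset.Iio i₀).lcm f) : ℕ)) (by exact_mod_cast hg i₀)
      lift r to ℕ using hr₀
      have key : ∀ k : Fin s, k.val < n →
          x i₀ - r ≡ x k - ℓ k [ZMOD (Nat.gcd (f i₀) (f k) : ℕ)] := by
        intro k hk
        have hk' : k ∈ Finset.Iio i₀ := Finset.mem_Iio.2 hk
        have h₁ : x i₀ - r ≡ z [ZMOD (Nat.gcd (f i₀) ((Finset.Iio i₀).lcm f) : ℕ)] := by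
          have := (Int.ModEq.refl (x i₀)).sub hr
          simpa using this
        refine (h₁.of_dvd ?_).trans ((hz k hk').of_dvd ?_)
        · exact Int.natCast_dvd_natCast.2 (Nat.gcd_dvd_gcd_of_dvd_right _ (Finset.dvd_lcm hk'))
        · exact Int.natCast_dvd_natCast.2 (Nat.gcd_dvd_right _ _)
      have hne : ∀ k : Fin s, k.val < n → k ≠ i₀ := fun k hk e => by
        rw [e] at hk; exact lt_irrefl _ hk
      have heq : ∀ k : Fin s, k.val < n + 1 → k.val < n ∨ k = i₀ := fun k hk => by
        rcases Nat.lt_succ_iff_lt_or_eq.1 hk with h | h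
        · exact .inl h
        · exact .inr (Fin.ext h)
      refine ⟨Function.update ℓ i₀ r, fun i => ?_, fun i k hi hk => ?_⟩
      · by_cases h : i = i₀
        · subst h; simpa using (by exact_mod_cast hr₁)
        · simpa [h] using hℓ i
      · rcases heq i hi with hi | rfl <;> rcases heq k hk with hk | rfl
        · simpa [hne i hi, hne k hk] using hc i k hi hk
        · have := (key i hi).symm
          rw [Nat.gcd_comm] at this
          simpa [hne i hi] using this
        · simpa [hne k hk] using key k hk
        · exact Int.ModEq.refl _
  obtain ⟨ℓ, hℓ, hc⟩ := hex s le_rfl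
  refine ⟨ℓ, ⟨hℓ, fun i k => hc i k i.2 k.2⟩, ?_⟩
  rintro ℓ' ⟨hℓ', hc'⟩
  funext i
  induction i using WellFoundedLT.induction with
  | ind i ih =>
    -- as `ℓ` and `ℓ'` agree before `i`, each `gcd (f i) (f k)` with `k < i` divides `ℓ i - ℓ' i`
    have hd : ((Nat.gcd (f i) ((Finset.Iio i).lcm f) : ℕ) : ℤ) ∣ (ℓ i : ℤ) - ℓ' i := by
      refine Finset.gcd_lcm_dvd hf (hf i) _ fun k hk => ?_
      have h₁ := (hc i k i.2 k.2).sub (hc' i k)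
      rw [ih k (Finset.mem_Iio.1 hk)] at h₁
      have h₂ := h₁.dvd
      ring_nf at h₂ ⊢
      exact h₂
    have h₁ : (ℓ' i : ℤ) ≡ ℓ i [ZMOD (Nat.gcd (f i) ((Finset.Iio i).lcm f) : ℕ)] :=
      Int.modEq_iff_dvd.2 hd
    exact (Int.natCast_modEq_iff.1 h₁).eq_of_lt_of_lt (hℓ' i) (hℓ i)

namespace FSR

lemma compPeriod_ne_zero {s : ℕ} {e : Fin s → ℕ} (he : ∀ i, e i ≠ 0) (a : Fin s → ZMod 2)
    (i : Fin s) : compPeriod e a i ≠ 0 := by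
  unfold compPeriod
  split_ifs
  exacts [he i, one_ne_zero]

/-- Among the shift parameters of `a`, exactly one makes the residues `x i - ℓ i`, for `i` in the
support of `a`, pairwise compatible. -/
lemma card_filter_shiftParameters {s : ℕ} {e : Fin s → ℕ} (he : ∀ i, e i ≠ 0)
    (a : Fin s → ZMod 2) (x : Fin s → ℤ)
    [DecidablePred fun ℓ : Fin s → ℕ => ∀ i k, i ≠ k → a i = 1 → a k = 1 →
      x i - ℓ i ≡ x k - ℓ k [ZMOD (Nat.gcd (e i) (e k) : ℤ)]] :
    ((shiftParameters e a).filter fun ℓ => ∀ i k, i ≠ k → a i = 1 → a k = 1 →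
      x i - ℓ i ≡ x k - ℓ k [ZMOD (Nat.gcd (e i) (e k) : ℤ)]).card = 1 := by
  rw [Finset.card_eq_one]
  obtain ⟨ℓ, ⟨h₁, h₂⟩, hu⟩ := existsUnique_shift_compatible (compPeriod_ne_zero he a) x
  have hiff : ∀ ℓ : Fin s → ℕ, (∀ i k, i ≠ k → a i = 1 → a k = 1 →
      x i - ℓ i ≡ x k - ℓ k [ZMOD (Nat.gcd (e i) (e k) : ℤ)]) ↔
      ∀ i k, x i - ℓ i ≡ x k - ℓ k
        [ZMOD (Nat.gcd (compPeriod e a i) (compPeriod e a k) : ℕ)] := by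
    intro ℓ
    constructor
    · intro h i k
      by_cases hik : i = k
      · subst hik; exact Int.ModEq.refl _
      by_cases hi : a i = 1
      · by_cases hk : a k = 1
        · simpa [compPeriod, hi, hk] using h i k hik hi hk
        · simp [compPeriod, hk, Int.modEq_one]
      · simp [compPeriod, hi, Int.modEq_one]
    · intro h i k _ hi hk
      simpa [compPeriod, hi, hk] using h i k
  refine ⟨ℓ, Finset.ext fun ℓ' => ?_⟩
  rw [Finset.mem_filter, hiff, Finset.mem_singleton]
  simp only [shiftParameters, Fintype.mem_piFinset, Finset.mem_range]
  exact ⟨fun h => hu ℓ' h, fun h => h ▸ ⟨h₁, h₂⟩⟩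

end FSR

/-! ### Sequences as a module over the shift operator -/

namespace FSR

/-- The left shift `L` as an endomorphism of the space of binary sequences. -/
def shiftEnd : Module.End (ZMod 2) BinSeq where
  toFun := shift 1
  map_add' _ _ := rfl
  map_smul' _ _ := rfl

lemma shift_zero (u : BinSeq) : shift 0 u = u := rfl

lemma shift_shift (k l : ℕ) (u : BinSeq) : shift k (shift l u) = shift (k + l) u := by
  funext m; simp [shift, add_assoc]

lemma shift_add (k : ℕ) (u v : BinSeq) : shift k (u + v) = shift k u + shift k v := rfl

lemma shift_smul (k : ℕ) (b : ZMod 2) (u : BinSeq) : shift k (b • u) = b • shift k u := rfl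

lemma shift_zero_seq (k : ℕ) : shift k (0 : BinSeq) = 0 := rfl

lemma shiftEnd_pow_apply (k : ℕ) (u : BinSeq) : (shiftEnd ^ k) u = shift k u := by
  induction k with
  | zero => rfl
  | succ k ih =>
    rw [pow_succ', Module.End.mul_apply, ih]
    change shift 1 (shift k u) = _
    rw [shift_shift, add_comm]

lemma monic_of_ne_zero {q : (ZMod 2)[X]} (hq : q ≠ 0) : q.Monic := by
  have h : ∀ b : ZMod 2, b ≠ 0 → b = 1 := by decide
  exact h _ (leadingCoeff_ne_zero.2 hq)

lemma aeval_shiftEnd_apply (q : (ZMod 2)[X]) (u : BinSeq) (m : ℕ) :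
    aeval shiftEnd q u m = ∑ i ∈ Finset.range (q.natDegree + 1), q.coeff i * u (m + i) := by
  rw [aeval_eq_sum_range]
  simp [LinearMap.sum_apply, shiftEnd_pow_apply, shift]

/-- The sequences generated by the LFSR of `q` are those annihilated by `q(L)`. -/
lemma mem_Omega_iff {q : (ZMod 2)[X]} (hq : q ≠ 0) (u : BinSeq) :
    u ∈ Omega q ↔ aeval shiftEnd q u = 0 := by
  have hl : q.coeff q.natDegree = 1 := monic_of_ne_zero hq
  change (∀ m, u (m + q.natDegree) = ∑ i : Fin q.natDegree, q.coeff i * u (m + i)) ↔ _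
  rw [funext_iff]
  refine forall_congr' fun m => ?_
  rw [aeval_shiftEnd_apply, Finset.sum_range_succ, hl, one_mul, Pi.zero_apply, add_comm,
    ← Fin.sum_univ_eq_sum_range (fun i => q.coeff i * u (m + i)), CharTwo.add_eq_zero, eq_comm]

lemma aeval_shiftEnd_shift {q : (ZMod 2)[X]} {u : BinSeq} (hu : aeval shiftEnd q u = 0) (k : ℕ) :
    aeval shiftEnd q (shift k u) = 0 := by
  rw [← shiftEnd_pow_apply, ← Module.End.mul_apply]
  have : aeval shiftEnd q * shiftEnd ^ k = shiftEnd ^ k * aeval shiftEnd q := by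
    rw [← aeval_X (R := ZMod 2) shiftEnd, ← map_pow, aeval_X, ← map_mul, ← map_mul, mul_comm]
  rw [this, Module.End.mul_apply, hu, map_zero]

lemma aeval_shiftEnd_of_dvd {q r : (ZMod 2)[X]} (h : q ∣ r) {u : BinSeq}
    (hu : aeval shiftEnd q u = 0) : aeval shiftEnd r u = 0 := by
  obtain ⟨t, rfl⟩ := h
  rw [mul_comm, map_mul, Module.End.mul_apply, hu, map_zero]

/-- A sequence generated by the LFSR of `q` is determined by its first `deg q` terms. -/
lemma eq_of_initialState_eq {q : (ZMod 2)[X]} {u v : BinSeq} (hu : u ∈ Omega q)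
    (hv : v ∈ Omega q) (h : initialState q.natDegree u = initialState q.natDegree v) : u = v := by
  refine ((lfsr q).eq_iff_eqOn_range_order u v hu hv).2 fun m hm => ?_
  exact congrFun h ⟨m, Finset.mem_range.1 hm⟩

/-- The sum of the spaces `Ω(p_i)` is direct when the `p_i` are pairwise coprime. -/
lemma eq_zero_of_sum_eq_zero {s : ℕ} {p : Fin s → (ZMod 2)[X]}
    (hp : Pairwise fun i k => IsCoprime (p i) (p k)) {x : Fin s → BinSeq}
    (hx : ∀ i, aeval shiftEnd (p i) (x i) = 0) (h : ∑ i, x i = 0) (i : Fin s) : x i = 0 := by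
  have hc : IsCoprime (p i) (∏ k ∈ Finset.univ.erase i, p k) :=
    IsCoprime.prod_right fun k hk => hp (Finset.ne_of_mem_erase hk).symm
  refine (LinearMap.disjoint_ker.1 (disjoint_ker_aeval_of_isCoprime shiftEnd hc)) _
    (LinearMap.mem_ker.2 (hx i)) (LinearMap.mem_ker.2 ?_)
  have h₁ := congrArg (aeval shiftEnd (∏ k ∈ Finset.univ.erase i, p k)) h
  rw [map_sum, map_zero, ← Finset.add_sum_erase _ _ (Finset.mem_univ i)] at h₁
  rwa [Finset.sum_eq_zero (s := Finset.univ.erase i) fun k hk =>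
    aeval_shiftEnd_of_dvd (Finset.dvd_prod_of_mem p hk) (hx k), add_zero] at h₁

lemma eq_of_sum_eq_sum {s : ℕ} {p : Fin s → (ZMod 2)[X]}
    (hp : Pairwise fun i k => IsCoprime (p i) (p k)) {x y : Fin s → BinSeq}
    (hx : ∀ i, aeval shiftEnd (p i) (x i) = 0) (hy : ∀ i, aeval shiftEnd (p i) (y i) = 0)
    (h : ∑ i, x i = ∑ i, y i) (i : Fin s) : x i = y i := by
  refine sub_eq_zero.1 (eq_zero_of_sum_eq_zero hp (x := fun i => x i - y i) (fun i => ?_) ?_ i)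
  · rw [map_sub, hx, hy, sub_zero]
  · rw [Finset.sum_sub_distrib, h, sub_self]

lemma shift_combination {s : ℕ} (k : ℕ) (a : Fin s → ZMod 2) (ℓ : Fin s → ℕ)
    (x : Fin s → BinSeq) :
    shift k (combination a ℓ x) = combination a (fun i => k + ℓ i) x := by
  simp only [combination]
  rw [← shiftEnd_pow_apply, map_sum]
  exact Finset.sum_congr rfl fun i _ => by
    rw [shiftEnd_pow_apply, shift_smul, shift_shift]

lemma aeval_shiftEnd_combination {s : ℕ} {q : (ZMod 2)[X]} {a : Fin s → ZMod 2} {ℓ : Fin s → ℕ}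
    {x : Fin s → BinSeq} (hx : ∀ i, aeval shiftEnd q (x i) = 0) :
    aeval shiftEnd q (combination a ℓ x) = 0 := by
  rw [combination, map_sum]
  exact Finset.sum_eq_zero fun i _ => by
    rw [map_smul, aeval_shiftEnd_shift (hx i), smul_zero]

/-! ### Conjugate states -/

lemma conjugate_eq_add {n : ℕ} (v : State n) : conjugate v = v + specialState n := by
  funext k
  by_cases h : (k : ℕ) = 0 <;> simp [conjugate, specialState, h]

lemma initialState_add (n : ℕ) (u v : BinSeq) :
    initialState n (u + v) = initialState n u + initialState n v := rfl

/-- Conjugate pairs are pairs of sequences whose sum is the sequence `z` through the special state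
`(1, 0, …, 0)`. -/
lemma sharedConjugatePairs_eq_image {q : (ZMod 2)[X]} (hq : q ≠ 0) {z : BinSeq}
    (hz : aeval shiftEnd q z = 0) (hzS : initialState q.natDegree z = specialState q.natDegree)
    {C₁ C₂ : Set BinSeq} (h₁ : ∀ u ∈ C₁, aeval shiftEnd q u = 0)
    (h₂ : ∀ u ∈ C₂, aeval shiftEnd q u = 0) :
    sharedConjugatePairs q.natDegree C₁ C₂ =
      (fun w : BinSeq × BinSeq => (initialState q.natDegree w.1, initialState q.natDegree w.2)) ''
        {w | w.1 ∈ C₁ ∧ w.2 ∈ C₂ ∧ w.1 + w.2 = z} := by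
  ext ⟨v, v'⟩
  constructor
  · rintro ⟨⟨x, hx, rfl⟩, ⟨y, hy, rfl⟩, h⟩
    refine ⟨(x, y), ⟨hx, hy, ?_⟩, rfl⟩
    refine eq_of_initialState_eq (q := q) ((mem_Omega_iff hq _).2 ?_)
      ((mem_Omega_iff hq _).2 hz) ?_
    · rw [map_add, h₁ x hx, h₂ y hy, add_zero]
    · rw [conjugate_eq_add] at h
      simp only at h
      rw [initialState_add, h, hzS, ← add_assoc, ZModModule.add_self, zero_add]
  · rintro ⟨⟨x, y⟩, ⟨hx, hy, hxy⟩, h⟩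
    obtain ⟨rfl, rfl⟩ := Prod.ext_iff.1 h
    refine ⟨⟨x, hx, rfl⟩, ⟨y, hy, rfl⟩, ?_⟩
    rw [conjugate_eq_add, ← hzS, ← hxy]
    simp only
    rw [initialState_add, ← add_assoc, ZModModule.add_self, zero_add]

lemma ncard_sharedConjugatePairs {q : (ZMod 2)[X]} (hq : q ≠ 0) {z : BinSeq}
    (hz : aeval shiftEnd q z = 0) (hzS : initialState q.natDegree z = specialState q.natDegree)
    {C₁ C₂ : Set BinSeq} (h₁ : ∀ u ∈ C₁, aeval shiftEnd q u = 0)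
    (h₂ : ∀ u ∈ C₂, aeval shiftEnd q u = 0) :
    (sharedConjugatePairs q.natDegree C₁ C₂).ncard =
      {w : BinSeq × BinSeq | w.1 ∈ C₁ ∧ w.2 ∈ C₂ ∧ w.1 + w.2 = z}.ncard := by
  rw [sharedConjugatePairs_eq_image hq hz hzS h₁ h₂, Set.InjOn.ncard_image]
  rintro ⟨x, y⟩ ⟨hx, hy, -⟩ ⟨x', y'⟩ ⟨hx', hy', -⟩ h
  obtain ⟨e₁, e₂⟩ := Prod.ext_iff.1 h
  exact Prod.ext
    (eq_of_initialState_eq ((mem_Omega_iff hq _).2 (h₁ _ hx))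
      ((mem_Omega_iff hq _).2 (h₁ _ hx')) e₁)
    (eq_of_initialState_eq ((mem_Omega_iff hq _).2 (h₂ _ hy))
      ((mem_Omega_iff hq _).2 (h₂ _ hy')) e₂)

/-! ### Cyclotomic classes -/

lemma zpow_add_mul_congr {K : Type*} [Field K] {α : K} {t e : ℕ} (hα : α ≠ 0)
    (ho : orderOf α = t * e) {i k l : ℤ}
    (hkl : k ≡ l [ZMOD e]) : α ^ (i + k * t) = α ^ (i + l * t) := by
  obtain ⟨q, hq⟩ := hkl.dvd
  have h₁ : i + l * t = i + k * t + (orderOf α : ℕ) * q := by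
    rw [ho]; push_cast; linear_combination (t : ℤ) * hq
  rw [h₁, zpow_add₀ hα _ (_ * q), zpow_mul, zpow_natCast, pow_orderOf_eq_one, one_zpow, mul_one]

/-- The elements `(α ^ t) ^ u * α ^ (j + t r)` with `u < e` run through the class of index `j`;
divided by a fixed element `α ^ (d + t r')` of the class of index `d`, they run through the class
of index `j - d`. -/
lemma mem_cyclotomicClass_sub_iff {K : Type*} [Field K] {α : K} {t e : ℕ} (hα : α ≠ 0)
    (he : 0 < e) (ho : orderOf α = t * e)
    (j d r r' : ℕ) (ξ : K) :
    ξ ∈ cyclotomicClass α t e ((j : ℤ) - d) ↔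
      ∃ u < e, ξ * α ^ (d + t * r') = (α ^ t) ^ u * α ^ (j + t * r) := by
  have he' : (0 : ℤ) < e := by exact_mod_cast he
  have hz : ∀ u : ℕ, (α ^ t) ^ u * α ^ (j + t * r) =
      α ^ ((j - d : ℤ) + (u + r - r') * t) * α ^ (d + t * r') := by
    intro u
    rw [← zpow_natCast α (d + _), ← zpow_add₀ hα, ← pow_mul, ← pow_add, ← zpow_natCast]
    congr 1
    push_cast
    ring
  have hne : α ^ (d + t * r') ≠ 0 := pow_ne_zero _ hα
  constructor
  · rintro ⟨k, -, rfl⟩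
    obtain ⟨u, hu₀, hu₁, hu⟩ := Int.existsUnique_equiv ((k : ℤ) - r + r') he'
    lift u to ℕ using hu₀
    refine ⟨u, by exact_mod_cast hu₁, ?_⟩
    rw [hz]
    congr 1
    refine zpow_add_mul_congr hα ho ?_
    have h₁ := ((hu.add_right r).sub_right r').symm
    have h₂ : (k : ℤ) - r + r' + r - r' = k := by ring
    rwa [h₂] at h₁
  · rintro ⟨u, -, hu⟩
    rw [hz, mul_left_inj' hne] at hu
    obtain ⟨k, hk₀, hk₁, hk⟩ := Int.existsUnique_equiv ((u : ℤ) + r - r') he'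
    lift k to ℕ using hk₀
    exact ⟨k, by exact_mod_cast hk₁, hu.trans (zpow_add_mul_congr hα ho hk.symm)⟩

/-! ### Sequences of `Ω(p)` as elements of the extension field -/

section Labelling

variable {p : (ZMod 2)[X]} {K : Type*} [Field K] [Algebra (ZMod 2) K] {α : K}
  {σ : Fin (polyIndex p) → BinSeq}

lemma CyclotomicLabelling.orderOf_pos (hp : Irreducible p) (h : CyclotomicLabelling p α σ) :
    0 < orderOf α := by
  rw [h.2.1, Nat.sub_pos_iff_lt]
  exact Nat.one_lt_two_pow hp.natDegree_pos.ne'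

lemma CyclotomicLabelling.ne_zero (hp : Irreducible p) (h : CyclotomicLabelling p α σ) :
    α ≠ 0 := by
  rintro rfl
  have h₁ := h.orderOf_pos hp
  rw [orderOf_zero] at h₁
  exact lt_irrefl _ h₁

lemma CyclotomicLabelling.orderOf_pow (hp : Irreducible p) (h : CyclotomicLabelling p α σ) :
    orderOf (α ^ polyIndex p) = polyOrder p := by
  have := Fact.mk hp
  have h₁ : eval₂ (algebraMap (ZMod 2) K) (α ^ polyIndex p) p = 0 := h.2.2.1
  -- the embedding of `𝔽₂[x] / (p)` into `K` that sends the root to `α ^ t`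
  have h₂ := orderOf_injective (AdjoinRoot.lift _ _ h₁).toMonoidHom
    (AdjoinRoot.lift _ _ h₁).injective (AdjoinRoot.root p)
  simpa [polyOrder] using h₂

lemma CyclotomicLabelling.polyOrder_pos (hp : Irreducible p) (h : CyclotomicLabelling p α σ) :
    0 < polyOrder p := by
  rw [← h.orderOf_pow hp]
  exact (orderOf_pos_iff.1 (h.orderOf_pos hp)).pow.orderOf_pos

lemma CyclotomicLabelling.orderOf_eq (hp : Irreducible p) (h : CyclotomicLabelling p α σ) :
    orderOf α = polyIndex p * polyOrder p := by
  have h₁ : polyOrder p ∣ 2 ^ p.natDegree - 1 := by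
    rw [← h.orderOf_pow hp, ← h.2.1]
    exact orderOf_pow_dvd _
  rw [polyIndex, Nat.div_mul_cancel h₁, h.2.1]

/-- The root `α ^ t` of `p` generates `K` over `𝔽₂`, as `K` has `2 ^ deg p` elements. -/
lemma CyclotomicLabelling.aeval_surjective (hp : Irreducible p)
    (h : CyclotomicLabelling p α σ) :
    Function.Surjective (aeval (α ^ polyIndex p) : (ZMod 2)[X] →ₐ[ZMod 2] K) := by
  have := Fact.mk hp
  have : Finite K := Nat.finite_of_card_ne_zero (by rw [h.1]; positivity)
  have h₁ : eval₂ (algebraMap (ZMod 2) K) (α ^ polyIndex p) p = 0 := h.2.2.1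
  have hcard : Nat.card (AdjoinRoot p) = 2 ^ p.natDegree := by
    have := (AdjoinRoot.powerBasis hp.ne_zero).finite
    rw [Module.natCard_eq_pow_finrank (K := ZMod 2), (AdjoinRoot.powerBasis hp.ne_zero).finrank,
      AdjoinRoot.powerBasis_dim, Nat.card_zmod]
  have hs : Function.Surjective (AdjoinRoot.lift _ _ h₁) :=
    ((Nat.bijective_iff_injective_and_card _).2
      ⟨(AdjoinRoot.lift _ _ h₁).injective, by rw [hcard, h.1]⟩).2
  intro η
  obtain ⟨y, rfl⟩ := hs η
  obtain ⟨q, rfl⟩ := AdjoinRoot.mk_surjective y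
  exact ⟨q, by rw [AdjoinRoot.lift_mk]; rfl⟩

/-- A sequence generated by the minimal polynomial of `α` is the sequence of values of a linear
functional at the powers of `α`. -/
lemma exists_functional_of_mem_Omega_minpoly (hα : IsIntegral (ZMod 2) α)
    (hs : Function.Surjective (aeval α : (ZMod 2)[X] →ₐ[ZMod 2] K)) {m : BinSeq}
    (hm : m ∈ Omega (minpoly (ZMod 2) α)) :
    ∃ lam : K →ₗ[ZMod 2] ZMod 2, ∀ k, m k = lam (α ^ k) := by
  rw [mem_Omega_iff (minpoly.ne_zero hα)] at hm
  let Lam : (ZMod 2)[X] →ₗ[ZMod 2] ZMod 2 :=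
    { toFun := fun q => aeval shiftEnd q m 0
      map_add' := fun q r => by simp
      map_smul' := fun b q => by simp }
  -- `λ` sends `q(α)` to `(q(L) m)_0`; it is well defined as `m` is annihilated by `minpoly α`
  obtain ⟨g, hg⟩ :=
    (aeval α : (ZMod 2)[X] →ₐ[ZMod 2] K).toLinearMap.exists_rightInverse_of_surjective
    (LinearMap.range_eq_top.2 hs)
  refine ⟨Lam ∘ₗ g, fun k => ?_⟩
  have h₁ : minpoly (ZMod 2) α ∣ g (α ^ k) - X ^ k := by
    refine minpoly.dvd _ _ ?_
    have := LinearMap.congr_fun hg (α ^ k)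
    simp only [LinearMap.comp_apply, AlgHom.toLinearMap_apply, LinearMap.id_apply] at this
    rw [map_sub, this, map_pow, aeval_X, sub_self]
  have h₂ := congrFun (aeval_shiftEnd_of_dvd h₁ hm) 0
  rw [map_sub, LinearMap.sub_apply, Pi.sub_apply, Pi.zero_apply, sub_eq_zero] at h₂
  change m k = aeval shiftEnd (g (α ^ k)) m 0
  rw [h₂, map_pow, aeval_X, shiftEnd_pow_apply, shift, zero_add]

/-- A cyclotomic labelling identifies the field `K` with sequences of `Ω(p)`, in such a way that the
shift becomes multiplication by the root `α ^ t` of `p`, and `σ j` becomes an element of the `j`-th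
cyclotomic class. With `m k = λ (α ^ k)`, the sequence of `ξ` is `k ↦ λ (ξ * α ^ (t * k))`. -/
lemma CyclotomicLabelling.exists_embedding (hp : Irreducible p)
    (h : CyclotomicLabelling p α σ) :
    ∃ φ : K →ₗ[ZMod 2] BinSeq, Function.Injective φ ∧
      (∀ ξ, aeval shiftEnd p (φ ξ) = 0) ∧
      (∀ k ξ, shift k (φ ξ) = φ ((α ^ polyIndex p) ^ k * ξ)) ∧
      ∀ j, ∃ r : ℕ, σ j = φ (α ^ ((j : ℕ) + polyIndex p * r)) := by
  have hfin : Finite K := Nat.finite_of_card_ne_zero (by rw [h.1]; positivity)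
  have hs := h.aeval_surjective hp
  have hs' : Function.Surjective (aeval α : (ZMod 2)[X] →ₐ[ZMod 2] K) := fun η => by
    obtain ⟨q, rfl⟩ := hs η
    exact ⟨q.comp (X ^ polyIndex p), by rw [aeval_comp, map_pow, aeval_X]⟩
  obtain ⟨m, hm, hm0, hmσ⟩ := h.2.2.2
  obtain ⟨lam, hlam⟩ :=
    exists_functional_of_mem_Omega_minpoly (Algebra.IsIntegral.isIntegral α) hs' hm
  let φ : K →ₗ[ZMod 2] BinSeq :=
    { toFun := fun ξ k => lam (ξ * (α ^ polyIndex p) ^ k)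
      map_add' := fun ξ η => by funext k; simp [add_mul]
      map_smul' := fun b ξ => by funext k; simp }
  have hφ : ∀ ξ k, φ ξ k = lam (ξ * (α ^ polyIndex p) ^ k) := fun _ _ => rfl
  have hshift : ∀ k ξ, shift k (φ ξ) = φ ((α ^ polyIndex p) ^ k * ξ) := by
    intro k ξ
    funext l
    rw [shift, hφ, hφ, pow_add]
    congr 1
    ring
  have haeval : ∀ (q : (ZMod 2)[X]) ξ,
      aeval shiftEnd q (φ ξ) = φ (aeval (α ^ polyIndex p) q * ξ) := by
    intro q ξ
    rw [aeval_eq_sum_range, aeval_eq_sum_range, LinearMap.sum_apply, Finset.sum_mul, map_sum]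
    refine Finset.sum_congr rfl fun i _ => ?_
    rw [LinearMap.smul_apply, shiftEnd_pow_apply, hshift, smul_mul_assoc, map_smul]
  refine ⟨φ, ?_, fun ξ => ?_, hshift, fun j => ?_⟩
  -- if `λ` vanishes on all `ξ * (α ^ t) ^ k` and `ξ ≠ 0`, then `λ = 0`, as `α ^ t` generates `K`
  · refine (injective_iff_map_eq_zero φ).2 fun ξ hξ => ?_
    by_contra hne
    refine hm0 (funext fun k => ?_)
    obtain ⟨q, hq⟩ := hs (α ^ k * ξ⁻¹)
    have h₁ := congrFun (haeval q ξ) 0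
    rw [hξ, map_zero, hφ, hq, inv_mul_cancel_right₀ hne, pow_zero, mul_one, ← hlam] at h₁
    exact h₁.symm
  · rw [haeval, h.2.2.1, zero_mul, map_zero]
  · have h₁ : σ j ∈ cycle (σ j) := ⟨0, rfl⟩
    rw [hmσ j] at h₁
    obtain ⟨r, hr⟩ := h₁
    refine ⟨r, ?_⟩
    rw [← hr]
    funext k
    change m (polyIndex p * (k + r) + j) = _
    rw [hlam, hφ]
    congr 1
    ring

lemma CyclotomicLabelling.aeval_apply (hp : Irreducible p) (h : CyclotomicLabelling p α σ)
    (j : Fin (polyIndex p)) : aeval shiftEnd p (σ j) = 0 := by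
  obtain ⟨φ, -, hφ, -, hσ⟩ := h.exists_embedding hp
  obtain ⟨r, hr⟩ := hσ j
  rw [hr, hφ]

lemma CyclotomicLabelling.apply_ne_zero (hp : Irreducible p) (h : CyclotomicLabelling p α σ)
    (j : Fin (polyIndex p)) : σ j ≠ 0 := by
  obtain ⟨φ, hinj, -, -, hσ⟩ := h.exists_embedding hp
  obtain ⟨r, hr⟩ := hσ j
  rw [hr, Ne, map_eq_zero_iff φ hinj]
  exact pow_ne_zero _ (h.ne_zero hp)

lemma CyclotomicLabelling.shift_eq_shift_iff (hp : Irreducible p)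
    (h : CyclotomicLabelling p α σ) (j : Fin (polyIndex p)) (u v : ℕ) :
    shift u (σ j) = shift v (σ j) ↔ u ≡ v [MOD polyOrder p] := by
  obtain ⟨φ, hinj, -, hshift, hσ⟩ := h.exists_embedding hp
  obtain ⟨r, hr⟩ := hσ j
  have hα := h.ne_zero hp
  rw [hr, hshift, hshift, hinj.eq_iff, mul_left_inj' (pow_ne_zero _ hα), ← h.orderOf_pow hp]
  have hγ : IsUnit (α ^ polyIndex p) := (isUnit_iff_ne_zero.2 hα).pow _
  obtain ⟨g, hg⟩ := hγ
  rw [← hg, orderOf_units, ← pow_eq_pow_iff_modEq, Units.ext_iff, Units.val_pow_eq_pow_val,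
    Units.val_pow_eq_pow_val]

/-- Sequences with different labels lie on different cycles. -/
lemma CyclotomicLabelling.eq_of_shift_eq (hp : Irreducible p) (h : CyclotomicLabelling p α σ)
    {j d : Fin (polyIndex p)} {u : ℕ} (hu : shift u (σ j) = σ d) : j = d := by
  obtain ⟨φ, hinj, -, hshift, hσ⟩ := h.exists_embedding hp
  obtain ⟨r, hr⟩ := hσ j
  obtain ⟨r', hr'⟩ := hσ d
  have hα := h.ne_zero hp
  rw [hr, hr', hshift, hinj.eq_iff, ← pow_mul, ← pow_add] at hu
  obtain ⟨g, hg⟩ := isUnit_iff_ne_zero.2 hα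
  rw [← hg, ← Units.val_pow_eq_pow_val, ← Units.val_pow_eq_pow_val, ← Units.ext_iff,
    pow_eq_pow_iff_modEq, ← orderOf_units, hg, h.orderOf_eq hp] at hu
  have h₁ := hu.of_mul_right (polyOrder p)
  have h₂ : (j : ℕ) ≡ d [MOD polyIndex p] := by
    simpa [Nat.ModEq, Nat.add_mod, Nat.mul_mod_right] using h₁
  exact Fin.ext (h₂.eq_of_lt_of_lt j.2 d.2)

/-- The pairs of shifts that turn `σ j` and `σ j'` into two sequences with sum `σ d` are counted by
a cyclotomic number: divide the equation `x + y = z` in `K` by `z`, and use `-1 = 1`. -/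
lemma CyclotomicLabelling.ncard_Gamma (hp : Irreducible p) (h : CyclotomicLabelling p α σ)
    (j j' d : Fin (polyIndex p)) :
    (Gamma (polyOrder p) (σ j) (σ j') (σ d)).ncard =
      cyclotomicNumber α (polyIndex p) (polyOrder p)
        (((j : ℕ) : ℤ) - ((d : ℕ) : ℤ)) (((j' : ℕ) : ℤ) - ((d : ℕ) : ℤ)) := by
  have hper := h.shift_eq_shift_iff hp
  have hne := h.apply_ne_zero hp
  obtain ⟨φ, hinj, -, hshift, hσ⟩ := h.exists_embedding hp
  obtain ⟨r, hr⟩ := hσ j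
  obtain ⟨r', hr'⟩ := hσ j'
  obtain ⟨r'', hr''⟩ := hσ d
  have hα := h.ne_zero hp
  have hz : α ^ ((d : ℕ) + polyIndex p * r'') ≠ 0 := pow_ne_zero _ hα
  have hcl : ∀ (i r : ℕ) (ξ : K), _ := fun i r ξ => mem_cyclotomicClass_sub_iff hα
    (h.polyOrder_pos hp) (h.orderOf_eq hp) i d r r'' ξ
  have hsum : ∀ u v : ℕ, shift u (σ j) + shift v (σ j') = σ d ↔
      (α ^ polyIndex p) ^ u * α ^ ((j : ℕ) + polyIndex p * r) +
        (α ^ polyIndex p) ^ v * α ^ ((j' : ℕ) + polyIndex p * r') =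
      α ^ ((d : ℕ) + polyIndex p * r'') := by
    intro u v
    rw [hr, hr', hr'', hshift, hshift, ← map_add, hinj.eq_iff]
  have : CharP K 2 := charP_of_injective_algebraMap (algebraMap (ZMod 2) K).injective 2
  rw [cyclotomicNumber]
  refine Set.ncard_congr (fun w _ => (α ^ polyIndex p) ^ w.1 *
    α ^ ((j : ℕ) + polyIndex p * r) / α ^ ((d : ℕ) + polyIndex p * r'')) ?_ ?_ ?_
  · rintro ⟨u, v⟩ ⟨hu, hv, -, -, huv⟩
    rw [hsum] at huv
    refine ⟨(hcl _ r _).2 ⟨u, hu, div_mul_cancel₀ _ hz⟩, (hcl _ r' _).2 ⟨v, hv, ?_⟩⟩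
    rw [add_mul, div_mul_cancel₀ _ hz, one_mul, ← huv, ← add_assoc, CharTwo.add_self_eq_zero,
      zero_add]
  · rintro ⟨u, v⟩ ⟨u', v'⟩ ⟨hu, hv, -, -, huv⟩ ⟨hu', hv', -, -, huv'⟩ heq
    simp only at hu hv hu' hv' huv huv'
    rw [div_left_inj' hz] at heq
    have h₁ : shift u (σ j) = shift u' (σ j) := by rw [hr, hshift, hshift, heq]
    have hu₂ : u = u' := ((hper j _ _).1 h₁).eq_of_lt_of_lt hu hu'
    rw [← huv', h₁, add_right_inj] at huv
    rw [hu₂, ((hper j' _ _).1 huv).eq_of_lt_of_lt hv hv']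
  · rintro ξ ⟨h₁, h₂⟩
    obtain ⟨u, hu, hu'⟩ := (hcl _ r ξ).1 h₁
    obtain ⟨v, hv, hv'⟩ := (hcl _ r' (ξ + 1)).1 h₂
    refine ⟨(u, v), ⟨hu, hv, fun e => absurd e (hne j), fun e => absurd e (hne j'), ?_⟩, ?_⟩
    · rw [hsum, ← hu', ← hv', add_mul, one_mul, ← add_assoc, CharTwo.add_self_eq_zero, zero_add]
    · rw [div_eq_iff hz, hu']

end Labelling

/-! ### Counting the pairs of sequences with prescribed sum -/

lemma zmod_two_eq_zero_of_ne_one {b : ZMod 2} (hb : b ≠ 1) : b = 0 := by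
  revert b; decide

lemma shift_mul_of_periodic {e : ℕ} {u : BinSeq} (hu : shift e u = u) (k : ℕ) :
    shift (k * e) u = u := by
  induction k with
  | zero => rw [zero_mul, shift_zero]
  | succ k ih => rw [Nat.succ_mul, ← shift_shift, hu, ih]

/-- The shift is injective on the sequences of period `e`: `L ^ (k (e - 1))` inverts `L ^ k`. -/
lemma shift_injective_of_periodic {e : ℕ} (he : 0 < e) {u v : BinSeq} (hu : shift e u = u)
    (hv : shift e v = v) {k : ℕ} (h : shift k u = shift k v) : u = v := by
  have hk : k * (e - 1) + k = k * e := by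
    rw [← Nat.mul_succ, Nat.succ_eq_add_one, Nat.sub_add_cancel he]
  have h₁ := congrArg (shift (k * (e - 1))) h
  rwa [shift_shift, shift_shift, hk, shift_mul_of_periodic hu, shift_mul_of_periodic hv] at h₁

section Count

variable {s : ℕ} {p : Fin s → (ZMod 2)[X]} {e : Fin s → ℕ} {x y z : Fin s → BinSeq}

lemma combination_eq_combination_iff (hp : Pairwise fun i k => IsCoprime (p i) (p k))
    (hx : ∀ i, aeval shiftEnd (p i) (x i) = 0)
    (hper : ∀ i u v, shift u (x i) = shift v (x i) ↔ u ≡ v [MOD e i])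
    (a : Fin s → ZMod 2) (m m' : Fin s → ℕ) :
    combination a m x = combination a m' x ↔ ∀ i, a i = 1 → m i ≡ m' i [MOD e i] := by
  constructor
  · intro h i hi
    have h₁ := eq_of_sum_eq_sum hp (x := fun i => a i • shift (m i) (x i))
      (y := fun i => a i • shift (m' i) (x i))
      (fun i => by rw [map_smul, aeval_shiftEnd_shift (hx i), smul_zero])
      (fun i => by rw [map_smul, aeval_shiftEnd_shift (hx i), smul_zero]) h i
    simp only [hi, one_smul] at h₁
    exact (hper i _ _).1 h₁
  · intro h
    refine Finset.sum_congr rfl fun i _ => ?_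
    by_cases hi : a i = 1
    · rw [(hper i _ _).2 (h i hi)]
    · rw [zmod_two_eq_zero_of_ne_one hi, zero_smul, zero_smul]

/-- Two combinations of the same components lie on one cycle exactly when the differences of their
shift parameters are pairwise compatible. -/
lemma combination_mem_cycle_iff (hp : Pairwise fun i k => IsCoprime (p i) (p k))
    (he : ∀ i, 0 < e i) (hx : ∀ i, aeval shiftEnd (p i) (x i) = 0)
    (hper : ∀ i u v, shift u (x i) = shift v (x i) ↔ u ≡ v [MOD e i])
    (a : Fin s → ZMod 2) (m ℓ : Fin s → ℕ) :
    combination a m x ∈ cycle (combination a ℓ x) ↔ ∀ i k, i ≠ k → a i = 1 → a k = 1 →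
      (m i : ℤ) - ℓ i ≡ (m k : ℤ) - ℓ k [ZMOD (Nat.gcd (e i) (e k) : ℤ)] := by
  have hiff : combination a m x ∈ cycle (combination a ℓ x) ↔
      ∃ q : ℕ, ∀ i, a i = 1 → q + ℓ i ≡ m i [MOD e i] := by
    simp only [cycle, Set.mem_range, shift_combination]
    exact exists_congr fun q => combination_eq_combination_iff hp hx hper a _ _
  rw [hiff]
  constructor
  · rintro ⟨q, hq⟩ i k - hi hk
    have h₁ : ∀ i, a i = 1 → (m i : ℤ) - ℓ i ≡ q [ZMOD e i] := fun i hi => by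
      have := ((Int.natCast_modEq_iff.2 (hq i hi)).symm).sub_right (ℓ i : ℤ)
      simpa using this
    exact ((h₁ i hi).of_dvd (Int.natCast_dvd_natCast.2 (Nat.gcd_dvd_left _ _))).trans
      ((h₁ k hk).of_dvd (Int.natCast_dvd_natCast.2 (Nat.gcd_dvd_right _ _))).symm
  · intro h
    obtain ⟨q, hq⟩ := Int.exists_forall_modEq (fun i => (he i).ne') (fun i => (m i : ℤ) - ℓ i)
      (Finset.univ.filter fun i => a i = 1) fun i hi k hk hik =>
        h i k hik (Finset.mem_filter.1 hi).2 (Finset.mem_filter.1 hk).2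
    -- a nonnegative representative of `q` modulo the common multiple `∏ e i`
    obtain ⟨r, hr₀, -, hr⟩ := Int.existsUnique_equiv q
      (b := (∏ i, e i : ℕ)) (by exact_mod_cast Finset.prod_pos fun i _ => he i)
    lift r to ℕ using hr₀
    refine ⟨r, fun i hi => Int.natCast_modEq_iff.1 ?_⟩
    have h₁ := (hr.of_dvd (Int.natCast_dvd_natCast.2
      (Finset.dvd_prod_of_mem e (Finset.mem_univ i)))).trans
        (hq i (Finset.mem_filter.2 ⟨Finset.mem_univ _, hi⟩))
    simpa using h₁.add_right (ℓ i : ℤ)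

/-- Every member of the cycle of a combination has shift parameters `m i + u i` with
`0 ≤ u i < e i`, and with `u i = 0` outside the support. -/
lemma exists_combination_eq_of_mem_cycle (hp : Pairwise fun i k => IsCoprime (p i) (p k))
    (he : ∀ i, 0 < e i) (hx : ∀ i, aeval shiftEnd (p i) (x i) = 0)
    (hper : ∀ i u v, shift u (x i) = shift v (x i) ↔ u ≡ v [MOD e i])
    (a : Fin s → ZMod 2) (m ℓ : Fin s → ℕ) {w : BinSeq} (hw : w ∈ cycle (combination a ℓ x)) :
    ∃ u : Fin s → ℕ, (∀ i, u i < e i) ∧ (∀ i, a i ≠ 1 → u i = 0) ∧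
      w = combination a (fun i => m i + u i) x := by
  obtain ⟨q, rfl⟩ := hw
  have h₁ : ∀ i, ∃ u : ℕ, u < e i ∧ (a i ≠ 1 → u = 0) ∧
      (a i = 1 → q + ℓ i ≡ m i + u [MOD e i]) := by
    intro i
    by_cases hi : a i = 1
    · obtain ⟨u, hu₀, hu₁, hu⟩ := Int.existsUnique_equiv ((q : ℤ) + ℓ i - m i)
        (b := e i) (by exact_mod_cast he i)
      lift u to ℕ using hu₀
      refine ⟨u, by exact_mod_cast hu₁, fun h => absurd hi h, fun _ => Int.natCast_modEq_iff.1 ?_⟩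
      have h₂ := (hu.add_left (m i : ℤ)).symm
      rw [add_sub_cancel] at h₂
      exact_mod_cast h₂
    · exact ⟨0, he i, fun _ => rfl, fun h => absurd h hi⟩
  choose u hu₁ hu₂ hu₃ using h₁
  refine ⟨u, hu₁, hu₂, ?_⟩
  change shift q _ = _
  rw [shift_combination]
  exact (combination_eq_combination_iff hp hx hper a _ _).2 hu₃

/-- The pairs of members of two cycles whose sum is a given sequence correspond, component by
component, to the elements of the sets `Γ`: compatibility of the shifts is what makes the components
of each summand come from one and the same shift of the cycle. -/
lemma ncard_pairs_with_sum (hp : Pairwise fun i k => IsCoprime (p i) (p k)) (he : ∀ i, 0 < e i)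
    (hx : ∀ i, aeval shiftEnd (p i) (x i) = 0) (hy : ∀ i, aeval shiftEnd (p i) (y i) = 0)
    (hz : ∀ i, aeval shiftEnd (p i) (z i) = 0) (hx0 : ∀ i, x i ≠ 0) (hy0 : ∀ i, y i ≠ 0)
    (hxper : ∀ i u v, shift u (x i) = shift v (x i) ↔ u ≡ v [MOD e i])
    (hyper : ∀ i u v, shift u (y i) = shift v (y i) ↔ u ≡ v [MOD e i])
    (hzper : ∀ i u v, shift u (z i) = shift v (z i) ↔ u ≡ v [MOD e i])
    (a a' : Fin s → ZMod 2) (ℓ ℓ' c : Fin s → ℕ) (h : ℕ) :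
    {w : BinSeq × BinSeq | w.1 ∈ cycle (combination a ℓ x) ∧ w.2 ∈ cycle (combination a' ℓ' y) ∧
      w.1 + w.2 = shift h (combination (fun _ => 1) c z)}.ncard =
    Set.ncard {w : Fin s → ℕ × ℕ |
      (∀ i, w i ∈ Gamma (e i) (a i • x i) (a' i • y i) (z i)) ∧
      (∀ i k, i ≠ k → a i = 1 → a k = 1 →
        (c i : ℤ) + ((w i).1 : ℤ) - (ℓ i : ℤ) ≡ (c k : ℤ) + ((w k).1 : ℤ) - (ℓ k : ℤ)
          [ZMOD (Nat.gcd (e i) (e k) : ℤ)]) ∧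
      (∀ i k, i ≠ k → a' i = 1 → a' k = 1 →
        (c i : ℤ) + ((w i).2 : ℤ) - (ℓ' i : ℤ) ≡ (c k : ℤ) + ((w k).2 : ℤ) - (ℓ' k : ℤ)
          [ZMOD (Nat.gcd (e i) (e k) : ℤ)])} := by
  have hsmul : ∀ {b : ZMod 2} {u : BinSeq}, u ≠ 0 → b • u = 0 → b ≠ 1 := by
    rintro b u hu hbu rfl
    exact hu (by rwa [one_smul] at hbu)
  have hcong : ∀ (b : Fin s → ZMod 2) (l u : Fin s → ℕ),
      (∀ i k, i ≠ k → b i = 1 → b k = 1 →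
        ((h + c i + u i : ℕ) : ℤ) - l i ≡ ((h + c k + u k : ℕ) : ℤ) - l k
          [ZMOD (Nat.gcd (e i) (e k) : ℤ)]) ↔
      (∀ i k, i ≠ k → b i = 1 → b k = 1 →
        (c i : ℤ) + u i - l i ≡ (c k : ℤ) + u k - l k [ZMOD (Nat.gcd (e i) (e k) : ℤ)]) := by
    intro b l u
    have h₁ : ∀ i, ((h + c i + u i : ℕ) : ℤ) - l i = h + ((c i : ℤ) + u i - l i) := fun i => by
      push_cast; ring
    refine forall₂_congr fun i k => forall₃_congr fun _ _ _ => ?_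
    rw [h₁, h₁]
    exact ⟨fun t => t.add_left_cancel' _, fun t => t.add_left _⟩
  have hsum : ∀ u v : Fin s → ℕ,
      combination a (fun i => h + c i + u i) x + combination a' (fun i => h + c i + v i) y =
        shift h (combination (fun _ => 1) c z) ↔
      ∀ i, shift (u i) (a i • x i) + shift (v i) (a' i • y i) = z i := by
    intro u v
    have h₁ : combination a (fun i => h + c i + u i) x +
        combination a' (fun i => h + c i + v i) y =
        ∑ i, shift (h + c i) (shift (u i) (a i • x i) + shift (v i) (a' i • y i)) := by
      rw [combination, combination, ← Finset.sum_add_distrib]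
      exact Finset.sum_congr rfl fun i _ => by
        rw [shift_add, shift_smul, shift_smul, shift_smul, shift_smul, shift_shift, shift_shift]
    have h₂ : shift h (combination (fun _ => 1) c z) = ∑ i, shift (h + c i) (z i) := by
      rw [shift_combination, combination]
      exact Finset.sum_congr rfl fun i _ => one_smul _ _
    have hself : ∀ {i} {t : Fin s → BinSeq},
        (∀ i u v, shift u (t i) = shift v (t i) ↔ u ≡ v [MOD e i]) → shift (e i) (t i) = t i :=
      fun {i t} ht => (ht i (e i) 0).2 (by simp [Nat.ModEq])
    rw [h₁, h₂]
    constructor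
    · intro hs i
      have h₃ := eq_of_sum_eq_sum hp (fun i => aeval_shiftEnd_shift (k := h + c i)
        (u := shift (u i) (a i • x i) + shift (v i) (a' i • y i)) (by
          rw [map_add, aeval_shiftEnd_shift (by rw [map_smul, hx, smul_zero]),
            aeval_shiftEnd_shift (by rw [map_smul, hy, smul_zero]), add_zero]))
        (fun i => aeval_shiftEnd_shift (hz i) _) hs i
      refine shift_injective_of_periodic (he i) ?_ (hself hzper) h₃
      rw [shift_add, shift_shift, shift_shift, add_comm (e i), add_comm (e i), ← shift_shift,
        ← shift_shift, shift_smul (e i), shift_smul (e i), hself hxper, hself hyper]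
    · intro hs
      exact Finset.sum_congr rfl fun i _ => by rw [hs]
  symm
  refine Set.ncard_congr (fun w _ => (combination a (fun i => h + c i + (w i).1) x,
    combination a' (fun i => h + c i + (w i).2) y)) ?_ ?_ ?_
  · rintro w ⟨hΓ, hc₁, hc₂⟩
    refine ⟨(combination_mem_cycle_iff hp he hx hxper a _ ℓ).2 ?_,
      (combination_mem_cycle_iff hp he hy hyper a' _ ℓ').2 ?_,
      (hsum _ _).2 fun i => (hΓ i).2.2.2.2⟩
    · exact (hcong a ℓ fun i => (w i).1).2 hc₁
    · exact (hcong a' ℓ' fun i => (w i).2).2 hc₂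
  · rintro w w' ⟨hΓ, -, -⟩ ⟨hΓ', -, -⟩ heq
    obtain ⟨h₁, h₂⟩ := Prod.ext_iff.1 heq
    have h₁' := (combination_eq_combination_iff hp hx hxper a _ _).1 h₁
    have h₂' := (combination_eq_combination_iff hp hy hyper a' _ _).1 h₂
    funext i
    refine Prod.ext ?_ ?_
    · by_cases hi : a i = 1
      · exact (Nat.ModEq.add_left_cancel' _ (h₁' i hi)).eq_of_lt_of_lt (hΓ i).1 (hΓ' i).1
      · have h₀ : a i • x i = 0 := by rw [zmod_two_eq_zero_of_ne_one hi, zero_smul]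
        rw [(hΓ i).2.2.1 h₀, (hΓ' i).2.2.1 h₀]
    · by_cases hi : a' i = 1
      · exact (Nat.ModEq.add_left_cancel' _ (h₂' i hi)).eq_of_lt_of_lt (hΓ i).2.1 (hΓ' i).2.1
      · have h₀ : a' i • y i = 0 := by rw [zmod_two_eq_zero_of_ne_one hi, zero_smul]
        rw [(hΓ i).2.2.2.1 h₀, (hΓ' i).2.2.2.1 h₀]
  · rintro ⟨w₁, w₂⟩ ⟨hw₁, hw₂, hw⟩
    simp only at hw₁ hw₂ hw
    obtain ⟨u, hu, hu0, rfl⟩ :=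
      exists_combination_eq_of_mem_cycle hp he hx hxper a (fun i => h + c i) ℓ hw₁
    obtain ⟨v, hv, hv0, rfl⟩ :=
      exists_combination_eq_of_mem_cycle hp he hy hyper a' (fun i => h + c i) ℓ' hw₂
    refine ⟨fun i => (u i, v i), ⟨fun i => ⟨hu i, hv i, fun h₀ => hu0 i (hsmul (hx0 i) h₀),
      fun h₀ => hv0 i (hsmul (hy0 i) h₀), (hsum u v).1 hw i⟩, ?_, ?_⟩, rfl⟩
    · exact (hcong a ℓ u).1 ((combination_mem_cycle_iff hp he hx hxper a _ ℓ).1 hw₁)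
    · exact (hcong a' ℓ' v).1 ((combination_mem_cycle_iff hp he hy hyper a' _ ℓ').1 hw₂)

end Count

/-! ### The sets `Γ` and the sum over the shift parameters -/

lemma Gamma_finite (e : ℕ) (x y z : BinSeq) : (Gamma e x y z).Finite :=
  ((Set.finite_Iio e).prod (Set.finite_Iio e)).subset fun _ hw => ⟨hw.1, hw.2.1⟩

lemma ncard_Gamma_zero_right {e : ℕ} (he : 0 < e) {x : BinSeq}
    (hper : ∀ u v, shift u x = shift v x ↔ u ≡ v [MOD e]) : (Gamma e x 0 x).ncard = 1 := by
  rw [Set.ncard_eq_one]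
  refine ⟨(0, 0), Set.ext fun ⟨u, v⟩ => ⟨?_, ?_⟩⟩
  · rintro ⟨hu, -, -, hv, h⟩
    rw [shift_zero_seq, add_zero] at h
    exact Prod.ext (((hper u 0).1 h).eq_of_lt_of_lt hu he) (hv rfl)
  · rintro ⟨⟩
    exact ⟨he, he, fun _ => rfl, fun _ => rfl, by rw [shift_zero_seq, add_zero, shift_zero]⟩

lemma Gamma_swap_image (e : ℕ) (x y z : BinSeq) :
    Prod.swap '' Gamma e x y z = Gamma e y x z := by
  rw [Set.image_swap_eq_preimage_swap]
  ext ⟨u, v⟩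
  simp only [Gamma, Set.mem_preimage, Set.mem_ofPred_eq, Prod.fst_swap, Prod.snd_swap]
  rw [add_comm]
  tauto

lemma ncard_Gamma_zero_left {e : ℕ} (he : 0 < e) {x : BinSeq}
    (hper : ∀ u v, shift u x = shift v x ↔ u ≡ v [MOD e]) : (Gamma e 0 x x).ncard = 1 := by
  rw [← Gamma_swap_image, Set.ncard_image_of_injective _ Prod.swap_injective,
    ncard_Gamma_zero_right he hper]

open scoped Classical in
/-- Double counting: if every `w` satisfies `P i w` for exactly one `i` and `Q k w` for exactly one
`k`, then every `w` is counted once. -/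
lemma sum_sum_card_filter_and {A B W : Type*} (SA : Finset A) (SB : Finset B) (SW : Finset W)
    (P : A → W → Prop) (Q : B → W → Prop)
    (hP : ∀ w ∈ SW, (SA.filter fun i => P i w).card = 1)
    (hQ : ∀ w ∈ SW, (SB.filter fun i => Q i w).card = 1) :
    ∑ i ∈ SA, ∑ k ∈ SB, (SW.filter fun w => P i w ∧ Q k w).card = SW.card := by
  have h₁ : ∀ i k, (SW.filter fun w => P i w ∧ Q k w).card =
      ∑ w ∈ SW, (if P i w then 1 else 0) * (if Q k w then 1 else 0) := by
    intro i k
    rw [Finset.card_filter]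
    refine Finset.sum_congr rfl fun w _ => ?_
    split_ifs <;> simp_all
  simp only [h₁]
  simp_rw [Finset.sum_comm (s := SB), ← Finset.mul_sum]
  rw [Finset.sum_comm, Finset.card_eq_sum_ones]
  refine Finset.sum_congr rfl fun w hw => ?_
  rw [← Finset.sum_mul, ← Finset.card_filter, ← Finset.card_filter, hP w hw, hQ w hw, mul_one]

end FSR

/-! ### Conjugate pairs shared by two cycles of `Ω(f)` -/

theorem mainTheorem1 {s : ℕ} (hs : 0 < s)
    (p : Fin s → (ZMod 2)[X]) (hirr : ∀ i, Irreducible (p i)) (hX : ∀ i, p i ≠ X)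
    (hdistinct : Function.Injective p)
    (f : (ZMod 2)[X]) (hf : f = ∏ i, p i)
    -- the nonzero cycles of each `Ω(p_i)`, numbered by the cyclotomic classes of `𝔽_{2^{n_i}}`
    (K : Fin s → Type*) [∀ i, Field (K i)] [∀ i, Algebra (ZMod 2) (K i)]
    (α : ∀ i, K i) (σ : ∀ i, Fin (FSR.polyIndex (p i)) → FSR.BinSeq)
    (hσ : ∀ i, FSR.CyclotomicLabelling (p i) (α i) (σ i))
    -- the cycle through the special state `(1, 0, …, 0)`
    (s₀ : FSR.BinSeq) (hs₀ : s₀ ∈ FSR.Omega f)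
    (hS : FSR.specialState f.natDegree ∈ FSR.states f.natDegree (FSR.cycle s₀))
    (c : Fin s → ℕ) (d : ∀ i, Fin (FSR.polyIndex (p i)))
    (hcd : FSR.cycle s₀ = FSR.cycle (FSR.combination (fun _ => 1) c fun i => σ i (d i)))
    -- the data `a_i, j_i` and `a'_i, j'_i` of the two cycles
    (a a' : Fin s → ZMod 2) (j j' : ∀ i, Fin (FSR.polyIndex (p i))) :
    -- 1. necessary conditions
    (∀ ℓ ℓ' : Fin s → ℕ,
      (FSR.sharedConjugatePairs f.natDegree
        (FSR.cycle (FSR.combination a ℓ fun i => σ i (j i)))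
        (FSR.cycle (FSR.combination a' ℓ' fun i => σ i (j' i)))).Nonempty →
      {i | a i = 1} ∪ {i | a' i = 1} = Set.univ ∧
      (∀ i, a i = 1 → ¬ a' i = 1 → σ i (j i) = σ i (d i)) ∧
      (∀ i, ¬ a i = 1 → a' i = 1 → σ i (j' i) = σ i (d i)) ∧
      (∀ i, a i = 1 → a' i = 1 →
        0 < FSR.cyclotomicNumber (α i) (FSR.polyIndex (p i)) (FSR.polyOrder (p i))
          (((j i : ℕ) : ℤ) - ((d i : ℕ) : ℤ)) (((j' i : ℕ) : ℤ) - ((d i : ℕ) : ℤ)))) ∧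
    -- 2. the number of shared conjugate pairs
    (∀ ℓ ℓ' : Fin s → ℕ,
      (FSR.sharedConjugatePairs f.natDegree
        (FSR.cycle (FSR.combination a ℓ fun i => σ i (j i)))
        (FSR.cycle (FSR.combination a' ℓ' fun i => σ i (j' i)))).ncard =
      Set.ncard {w : Fin s → ℕ × ℕ |
        (∀ i, w i ∈ FSR.Gamma (FSR.polyOrder (p i))
          (a i • σ i (j i)) (a' i • σ i (j' i)) (σ i (d i))) ∧
        (∀ i k, i ≠ k → a i = 1 → a k = 1 →
          (c i : ℤ) + ((w i).1 : ℤ) - (ℓ i : ℤ) ≡ (c k : ℤ) + ((w k).1 : ℤ) - (ℓ k : ℤ)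
            [ZMOD (Nat.gcd (FSR.polyOrder (p i)) (FSR.polyOrder (p k)) : ℤ)]) ∧
        (∀ i k, i ≠ k → a' i = 1 → a' k = 1 →
          (c i : ℤ) + ((w i).2 : ℤ) - (ℓ' i : ℤ) ≡ (c k : ℤ) + ((w k).2 : ℤ) - (ℓ' k : ℤ)
            [ZMOD (Nat.gcd (FSR.polyOrder (p i)) (FSR.polyOrder (p k)) : ℤ)])}) ∧
    -- 3. the sum over all shift parameters
    ({i | a i = 1} ∪ {i | a' i = 1} = Set.univ →
      (∀ i, a i = 1 → ¬ a' i = 1 → σ i (j i) = σ i (d i)) →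
      (∀ i, ¬ a i = 1 → a' i = 1 → σ i (j' i) = σ i (d i)) →
      ∑ ℓ ∈ FSR.shiftParameters (fun i => FSR.polyOrder (p i)) a,
        ∑ ℓ' ∈ FSR.shiftParameters (fun i => FSR.polyOrder (p i)) a',
          (FSR.sharedConjugatePairs f.natDegree
            (FSR.cycle (FSR.combination a ℓ fun i => σ i (j i)))
            (FSR.cycle (FSR.combination a' ℓ' fun i => σ i (j' i)))).ncard =
      ∏ i with a i = 1 ∧ a' i = 1,
        FSR.cyclotomicNumber (α i) (FSR.polyIndex (p i)) (FSR.polyOrder (p i))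
          (((j i : ℕ) : ℤ) - ((d i : ℕ) : ℤ)) (((j' i : ℕ) : ℤ) - ((d i : ℕ) : ℤ))) := by
  have hf0 : f ≠ 0 := by
    rw [hf]
    exact Finset.prod_ne_zero_iff.2 fun i _ => (hirr i).ne_zero
  have hp : Pairwise fun i k => IsCoprime (p i) (p k) := fun i k hik =>
    ((hirr i).coprime_iff_not_dvd).2 fun hd => hik <| hdistinct <|
      eq_of_monic_of_associated (FSR.monic_of_ne_zero (hirr i).ne_zero)
        (FSR.monic_of_ne_zero (hirr k).ne_zero) ((hirr i).associated_of_dvd (hirr k) hd)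
  have he : ∀ i, 0 < FSR.polyOrder (p i) := fun i => (hσ i).polyOrder_pos (hirr i)
  have hker : ∀ i k, aeval FSR.shiftEnd (p i) (σ i k) = 0 := fun i =>
    (hσ i).aeval_apply (hirr i)
  have hne : ∀ i k, σ i k ≠ 0 := fun i => (hσ i).apply_ne_zero (hirr i)
  have hper : ∀ i k u v, FSR.shift u (σ i k) = FSR.shift v (σ i k) ↔
      u ≡ v [MOD FSR.polyOrder (p i)] := fun i => (hσ i).shift_eq_shift_iff (hirr i)
  have hcomb : ∀ (b : Fin s → ZMod 2) (l : Fin s → ℕ) (k : ∀ i, Fin (FSR.polyIndex (p i))),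
      aeval FSR.shiftEnd f (FSR.combination b l fun i => σ i (k i)) = 0 := fun b l k =>
    FSR.aeval_shiftEnd_combination fun i => FSR.aeval_shiftEnd_of_dvd
      (hf ▸ Finset.dvd_prod_of_mem p (Finset.mem_univ i)) (hker i (k i))
  have hcyc : ∀ (b : Fin s → ZMod 2) (l : Fin s → ℕ) (k : ∀ i, Fin (FSR.polyIndex (p i))),
      ∀ u ∈ FSR.cycle (FSR.combination b l fun i => σ i (k i)), aeval FSR.shiftEnd f u = 0 := by
    rintro b l k _ ⟨r, rfl⟩
    exact FSR.aeval_shiftEnd_shift (hcomb b l k) r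
  -- the member of the cycle of `s₀` whose initial state is the special state
  obtain ⟨_, hz, hzS⟩ := hS
  rw [hcd] at hz
  obtain ⟨h, rfl⟩ := hz
  have hcount : ∀ ℓ ℓ' : Fin s → ℕ, _ := fun ℓ ℓ' =>
    (FSR.ncard_sharedConjugatePairs hf0 (hcyc _ _ _ _ ⟨h, rfl⟩) hzS (hcyc a ℓ j)
      (hcyc a' ℓ' j')).trans
    (FSR.ncard_pairs_with_sum hp he (fun i => hker i _) (fun i => hker i _)
      (fun i => hker i _) (fun i => hne i _) (fun i => hne i _) (fun i => hper i _)
      (fun i => hper i _) (fun i => hper i _) a a' ℓ ℓ' c h)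
  have hzero : ∀ {b : ZMod 2} (u : FSR.BinSeq), b ≠ 1 → b • u = 0 := fun u hb => by
    rw [FSR.zmod_two_eq_zero_of_ne_one hb, zero_smul]
  refine ⟨fun ℓ ℓ' hshare => ?_, hcount, fun hU hb₁ hb₂ => ?_⟩
  · have hpos := (Set.ncard_pos (Set.toFinite _)).2 hshare
    rw [hcount] at hpos
    obtain ⟨w, hw, -, -⟩ := Set.nonempty_of_ncard_ne_zero hpos.ne'
    have heq := fun i => (hw i).2.2.2.2
    refine ⟨Set.eq_univ_of_forall fun i => ?_, fun i h₁ h₂ => ?_, fun i h₁ h₂ => ?_,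
      fun i h₁ h₂ => ?_⟩
    · by_contra hi
      rw [Set.mem_union, not_or] at hi
      refine hne i (d i) ?_
      rw [← heq i, hzero _ hi.1, hzero _ hi.2, FSR.shift_zero_seq, FSR.shift_zero_seq, add_zero]
    · have h₃ := heq i
      rw [h₁, one_smul, hzero _ h₂, FSR.shift_zero_seq, add_zero] at h₃
      rw [(hσ i).eq_of_shift_eq (hirr i) h₃]
    · have h₃ := heq i
      rw [h₂, one_smul, hzero _ h₁, FSR.shift_zero_seq, zero_add] at h₃
      rw [(hσ i).eq_of_shift_eq (hirr i) h₃]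
    · have h₃ := hw i
      rw [h₁, h₂, one_smul, one_smul] at h₃
      rw [← (hσ i).ncard_Gamma (hirr i)]
      exact (Set.ncard_pos (FSR.Gamma_finite _ _ _ _)).2 ⟨_, h₃⟩
  · classical
    let G : Fin s → Finset (ℕ × ℕ) := fun i =>
      (FSR.Gamma_finite (FSR.polyOrder (p i)) (a i • σ i (j i)) (a' i • σ i (j' i))
        (σ i (d i))).toFinset
    have hG : ∀ i, (G i).card = if a i = 1 ∧ a' i = 1 then
        FSR.cyclotomicNumber (α i) (FSR.polyIndex (p i)) (FSR.polyOrder (p i))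
          (((j i : ℕ) : ℤ) - ((d i : ℕ) : ℤ)) (((j' i : ℕ) : ℤ) - ((d i : ℕ) : ℤ)) else 1 := by
      intro i
      refine (Set.ncard_eq_toFinset_card _ (FSR.Gamma_finite _ _ _ _)).symm.trans ?_
      by_cases h₁ : a i = 1 <;> by_cases h₂ : a' i = 1
      · rw [if_pos ⟨h₁, h₂⟩, h₁, h₂, one_smul, one_smul, (hσ i).ncard_Gamma (hirr i)]
      · rw [if_neg fun h => h₂ h.2, h₁, one_smul, hzero _ h₂, hb₁ i h₁ h₂,
          FSR.ncard_Gamma_zero_right (he i) (hper i _)]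
      · rw [if_neg fun h => h₁ h.1, h₂, one_smul, hzero _ h₁, hb₂ i h₁ h₂,
          FSR.ncard_Gamma_zero_left (he i) (hper i _)]
      · have hi : i ∈ {i | a i = 1} ∪ {i | a' i = 1} := hU ▸ Set.mem_univ i
        exact absurd hi fun h => h.elim h₁ h₂
    have hset : ∀ ℓ ℓ' : Fin s → ℕ, _ = _ := fun ℓ ℓ' => (hcount ℓ ℓ').trans <|
      (congrArg Set.ncard (Set.ext fun w => by
        simp only [Finset.coe_filter, Fintype.mem_piFinset, G,
          Set.Finite.mem_toFinset])).trans (Set.ncard_coe_finset ((Fintype.piFinset G).filter fun w =>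
          (∀ i k, i ≠ k → a i = 1 → a k = 1 →
            (c i : ℤ) + ((w i).1 : ℤ) - (ℓ i : ℤ) ≡ (c k : ℤ) + ((w k).1 : ℤ) - (ℓ k : ℤ)
              [ZMOD (Nat.gcd (FSR.polyOrder (p i)) (FSR.polyOrder (p k)) : ℤ)]) ∧
          (∀ i k, i ≠ k → a' i = 1 → a' k = 1 →
            (c i : ℤ) + ((w i).2 : ℤ) - (ℓ' i : ℤ) ≡ (c k : ℤ) + ((w k).2 : ℤ) - (ℓ' k : ℤ)
              [ZMOD (Nat.gcd (FSR.polyOrder (p i)) (FSR.polyOrder (p k)) : ℤ)])))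
    simp only [hset]
    rw [Finset.prod_filter, ← Finset.prod_congr rfl fun i _ => hG i, ← Fintype.card_piFinset]
    -- every tuple is counted for exactly one pair of shift parameters
    convert FSR.sum_sum_card_filter_and _ _ (Fintype.piFinset G) _ _ (fun w _ => ?_)
      fun w _ => ?_
    · convert FSR.card_filter_shiftParameters (fun i => (he i).ne') a fun i => c i + (w i).1
    · convert FSR.card_filter_shiftParameters (fun i => (he i).ne') a' fun i => c i + (w i).2
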